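/- \textbf{Theorem.} Let $\mathcal{C}$ be a semi-abelian category, that is, a pointed category with binary coproducts which is Barr exact (finite limits, coequalisers of kernel pairs, regular epimorphisms stable under pullback, and every internal equivalence relation is a kernel pair) and Bourn protomodular (every change-of-base functor between its categories of points reflects isomorphisms). A monomorphism, or the subobject it represents, is called \emph{normal} when it is the kernel of some morphism. A subobject $h\colon H\rightarrowtail G$ is called \emph{characteristic} when for every object $B$ and every split extension $$G\xrightarrow{\;k\;}A\underset{\beta}{\overset{\alpha}{\rightleftarrows}}B,\qquad \alpha\beta=1_B,\quad k=\ker\alpha,$$ of $B$ by $G$ there exist a split extension $(k',A',\alpha',\beta')$ of $B$ by $H$ and a morphism $h'\colon A'\to A$ with $h'k'=kh$, $\alpha h'=\alpha'$ and $h'\beta'=\beta$. For an object $B$, let $\mathrm{Pt}_B(\mathcal{C})$ be the (pointed) category of points over $B$: its objects are triples $(A,\alpha\colon A\to B,\beta\colon B\to A)$ with $\alpha\beta=1_B$, and its morphisms are the morphisms in $\mathcal{C}$ commuting with the projections $\alpha$ and with the sections $\beta$. Let $\mathrm{Ker}_B\colon \mathrm{Pt}_B(\mathcal{C})\to\mathcal{C}$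 be the functor sending $(A,\alpha,\beta)$ to the kernel of $\alpha$. A functor $F\colon\mathcal{D}\to\mathcal{E}$ between pointed categories \emph{creates normal subobjects} when for every object $A$ of $\mathcal{D}$ and every normal subobject $k'\colon K'\rightarrowtail F(A)$ in $\mathcal{E}$ there is a unique normal subobject $k\colon K\rightarrowtail A$ in $\mathcal{D}$ such that $F(k)=k'$ as subobjects of $F(A)$. Then the following conditions are equivalent: \begin{enumerate} \item[(i)] normality is transitive in $\mathcal{C}$ (ToN): any composite of two normal monomorphisms is a normal monomorphism; \item[(ii)] every normal subobject in $\mathcal{C}$ is characteristic; \item[(iii)] for each object $B$ of $\mathcal{C}$, the kernel functor $\mathrm{Ker}_B\colon \mathrm{Pt}_B(\mathcal{C})\to\mathcal{C}$ creates normal subobjects. \end{enumerate} -/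

import Mathlib

open CategoryTheory CategoryTheory.Limits

universe v u

namespace SemiAbelianCat

section Exactness

/-- A category is exact in the sense of Barr when it is regular (finite limits, coequalisers of
kernel pairs, regular epimorphisms stable under pullback) and every internal equivalence relation
is effective, that is, the kernel pair of some morphism. -/
class BarrExact (C : Type u) [Category.{v} C] : Prop extends Regular C where
  exists_isKernelPair : ∀ {R X : C} (p₁ p₂ : R ⟶ X), IsEquivalenceRelation p₁ p₂ →
    ∃ (Y : C) (q : X ⟶ Y), IsKernelPair q p₁ p₂

end Exactness

section Points

variable {C : Type u} [Category.{v} C]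

/-- A point over `B`: a split epimorphism `α : A ⟶ B` with a chosen section `β`. -/
structure Point (B : C) where
  A : C
  α : A ⟶ B
  β : B ⟶ A
  section_comp : β ≫ α = 𝟙 B

attribute [simp] Point.section_comp

/-- A morphism of points over `B`: it commutes with the projections and with the sections. -/
@[ext]
structure Point.Hom {B : C} (P Q : Point B) where
  f : P.A ⟶ Q.A
  comp_α : f ≫ Q.α = P.α
  β_comp : P.β ≫ f = Q.β

attribute [simp] Point.Hom.comp_α Point.Hom.β_comp

/-- The category `Pt_B(C)` of points over `B`. -/
instance Point.category (B : C) : Category.{v} (Point B) where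
  Hom P Q := Point.Hom P Q
  id P := ⟨𝟙 P.A, by simp, by simp⟩
  comp φ ψ := ⟨φ.f ≫ ψ.f, by simp, by rw [← Category.assoc, φ.β_comp, ψ.β_comp]⟩
  id_comp φ := Point.Hom.ext (Category.id_comp φ.f)
  comp_id φ := Point.Hom.ext (Category.comp_id φ.f)
  assoc φ ψ χ := Point.Hom.ext (Category.assoc φ.f ψ.f χ.f)

@[ext]
theorem Point.hom_ext {B : C} {P Q : Point B} {φ ψ : P ⟶ Q}
    (h : Point.Hom.f φ = Point.Hom.f ψ) : φ = ψ :=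
  Point.Hom.ext h

@[simp]
theorem Point.id_f {B : C} (P : Point B) : Point.Hom.f (𝟙 P) = 𝟙 P.A := rfl

@[simp]
theorem Point.comp_f {B : C} {P Q S : Point B} (φ : P ⟶ Q) (ψ : Q ⟶ S) :
    Point.Hom.f (φ ≫ ψ) = Point.Hom.f φ ≫ Point.Hom.f ψ := rfl

/-- The zero morphism `P ⟶ Q` of `Pt_B(C)` is the composite of the projection of `P` with the
section of `Q`. -/
instance Point.hasZeroMorphisms (B : C) : HasZeroMorphisms (Point B) where
  zero P Q := ⟨⟨P.α ≫ Q.β, by simp, by rw [← Category.assoc, P.section_comp, Category.id_comp]⟩⟩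
  comp_zero {P Q} φ S := Point.Hom.ext (by
    change φ.f ≫ Q.α ≫ S.β = P.α ≫ S.β
    rw [← Category.assoc, φ.comp_α])
  zero_comp P {Q S} φ := Point.Hom.ext (by
    change (P.α ≫ Q.β) ≫ φ.f = P.α ≫ S.β
    rw [Category.assoc, φ.β_comp])

@[simp]
theorem Point.zero_f {B : C} (P Q : Point B) :
    Point.Hom.f (0 : P ⟶ Q) = P.α ≫ Q.β := rfl

/-- The category of points is pointed: the identity point is a zero object. -/
instance Point.hasZeroObject (B : C) : HasZeroObject (Point B) where
  zero := ⟨⟨B, 𝟙 B, 𝟙 B, Category.comp_id _⟩, by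
    rw [IsZero.iff_id_eq_zero]
    ext
    simp⟩

/-- The pullback of a point over `B` along a morphism `v : B' ⟶ B`. -/
noncomputable abbrev Point.pullbackObj [HasPullbacks C] {B' B : C} (v : B' ⟶ B) (P : Point B) :
    Point B' where
  A := pullback P.α v
  α := pullback.snd P.α v
  β := pullback.lift (v ≫ P.β) (𝟙 B') (by simp)
  section_comp := pullback.lift_snd _ _ _

/-- The morphism `P.A ×_B B' ⟶ Q.A ×_B B'` induced by a morphism of points `φ : P ⟶ Q`. -/
noncomputable def Point.pullbackHom [HasPullbacks C] {B' B : C} (v : B' ⟶ B) {P Q : Point B}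
    (φ : P ⟶ Q) : pullback P.α v ⟶ pullback Q.α v :=
  pullback.lift (pullback.fst P.α v ≫ φ.f) (pullback.snd P.α v)
    (by rw [Category.assoc, φ.comp_α, pullback.condition])

theorem Point.pullbackHom_fst [HasPullbacks C] {B' B : C} (v : B' ⟶ B) {P Q : Point B}
    (φ : P ⟶ Q) :
    Point.pullbackHom v φ ≫ pullback.fst Q.α v = pullback.fst P.α v ≫ φ.f :=
  pullback.lift_fst _ _ _

theorem Point.pullbackHom_snd [HasPullbacks C] {B' B : C} (v : B' ⟶ B) {P Q : Point B}
    (φ : P ⟶ Q) :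
    Point.pullbackHom v φ ≫ pullback.snd Q.α v = pullback.snd P.α v :=
  pullback.lift_snd _ _ _

theorem Point.lift_pullbackHom [HasPullbacks C] {B' B : C} (v : B' ⟶ B) {P Q : Point B}
    (φ : P ⟶ Q) :
    pullback.lift (v ≫ P.β) (𝟙 B') (by simp) ≫ Point.pullbackHom v φ =
      pullback.lift (v ≫ Q.β) (𝟙 B') (by simp) := by
  apply pullback.hom_ext
  · rw [Category.assoc, Point.pullbackHom_fst, pullback.lift_fst, pullback.lift_fst_assoc,
      Category.assoc, φ.β_comp]
  · rw [Category.assoc, Point.pullbackHom_snd, pullback.lift_snd, pullback.lift_snd]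

theorem Point.pullbackHom_id [HasPullbacks C] {B' B : C} (v : B' ⟶ B) (P : Point B) :
    Point.pullbackHom v (𝟙 P) = 𝟙 (pullback P.α v) := by
  apply pullback.hom_ext
  · rw [Point.pullbackHom_fst, Point.id_f, Category.comp_id, Category.id_comp]
  · rw [Point.pullbackHom_snd, Category.id_comp]

theorem Point.pullbackHom_comp [HasPullbacks C] {B' B : C} (v : B' ⟶ B) {P Q S : Point B}
    (φ : P ⟶ Q) (ψ : Q ⟶ S) :
    Point.pullbackHom v (φ ≫ ψ) = Point.pullbackHom v φ ≫ Point.pullbackHom v ψ := by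
  apply pullback.hom_ext
  · rw [Category.assoc, Point.pullbackHom_fst, Point.pullbackHom_fst, ← Category.assoc,
      Point.pullbackHom_fst, Point.comp_f, Category.assoc]
  · rw [Category.assoc, Point.pullbackHom_snd, Point.pullbackHom_snd, Point.pullbackHom_snd]

/-- The change-of-base functor `v^* : Pt_B(C) ⥤ Pt_{B'}(C)` along `v : B' ⟶ B`, which pulls a
point back along `v`. -/
noncomputable def Point.changeOfBase [HasPullbacks C] {B' B : C} (v : B' ⟶ B) :
    Point B ⥤ Point B' where
  obj P := Point.pullbackObj v P
  map φ :=
    { f := Point.pullbackHom v φ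
      comp_α := Point.pullbackHom_snd v φ
      β_comp := Point.lift_pullbackHom v φ }
  map_id P := Point.hom_ext (Point.pullbackHom_id v P)
  map_comp φ ψ := Point.hom_ext (Point.pullbackHom_comp v φ ψ)

end Points

/-- A category is protomodular in the sense of Bourn when it has finite limits and every
change-of-base functor of its fibration of points reflects isomorphisms. -/
class Protomodular (C : Type u) [Category.{v} C] : Prop extends HasFiniteLimits C where
  reflectsIsomorphisms : ∀ {B' B : C} (v : B' ⟶ B),
    (Point.changeOfBase v).ReflectsIsomorphisms

/-- A semi-abelian category is a pointed, Barr exact, Bourn protomodular category with binary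
coproducts. -/
class SemiAbelian (C : Type u) [Category.{v} C] : Prop extends
  HasZeroObject C, BarrExact C, Protomodular C, HasBinaryCoproducts C

section Normality

variable {C : Type u} [Category.{v} C] [HasZeroMorphisms C]

/-- A morphism is a normal monomorphism when it is a kernel of some morphism. -/
def IsNormalMono {X Y : C} (f : X ⟶ Y) : Prop :=
  Nonempty (NormalMono f)

/-- A subobject is normal when it is the kernel of some morphism. -/
def IsNormalSubobject {A : C} (K : Subobject A) : Prop :=
  IsNormalMono K.arrow

variable (C) in
/-- Transitivity of normality (ToN): composites of normal monomorphisms are normal. -/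
def TransitivityOfNormality : Prop :=
  ∀ {X Y Z : C} (f : X ⟶ Y) (g : Y ⟶ Z), IsNormalMono f → IsNormalMono g → IsNormalMono (f ≫ g)

/-- A split extension of `B` by `X`. -/
structure SplitExtension (B X : C) where
  A : C
  κ : X ⟶ A
  α : A ⟶ B
  β : B ⟶ A
  section_comp : β ≫ α = 𝟙 B
  zero : κ ≫ α = 0
  isKernel : IsLimit (KernelFork.ofι κ zero)

/-- A morphism of split extensions. -/
structure SplitExtension.Hom {B' X' B X : C} (E' : SplitExtension B' X')
    (E : SplitExtension B X) where
  onKernel : X' ⟶ X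
  onTotal : E'.A ⟶ E.A
  onBase : B' ⟶ B
  comm_κ : E'.κ ≫ onTotal = onKernel ≫ E.κ
  comm_α : E'.α ≫ onBase = onTotal ≫ E.α
  comm_β : E'.β ≫ onTotal = onBase ≫ E.β

/-- A subobject `h : H ⟶ G` is characteristic when every split extension of any `B` by `G` receives
a morphism from a split extension of `B` by `H` which is `h` on kernels and the identity on `B`. -/
def IsCharacteristic {G : C} (H : Subobject G) : Prop :=
  ∀ (B : C) (E : SplitExtension B G),
    ∃ (E' : SplitExtension B (H : C)) (φ : E'.Hom E), φ.onKernel = H.arrow ∧ φ.onBase = 𝟙 B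

/-- The kernel functor `Ker_B : Pt_B(C) ⥤ C` sends a point `(A, α, β)` to the kernel of `α`. -/
noncomputable def kernelFunctor [HasKernels C] (B : C) : Point B ⥤ C where
  obj P := kernel P.α
  map {P Q} φ := kernel.map P.α Q.α φ.f (𝟙 B) (by rw [φ.comp_α, Category.comp_id])
  map_id P := by
    apply equalizer.hom_ext
    simp
  map_comp φ ψ := by
    apply equalizer.hom_ext
    simp

/-- A functor creates normal subobjects when for each object `A` and each normal subobject `K'` of
`F A` there is a unique normal subobject `K` of `A` with `F K = K'`. The equality `F K = K'` of
subobjects is an isomorphism over `F A` between their representatives. -/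
def CreatesNormalSubobjects {D : Type*} [Category* D] [HasZeroMorphisms D] (F : C ⥤ D) : Prop :=
  ∀ (A : C) (K' : Subobject (F.obj A)), IsNormalSubobject K' →
    ∃! K : Subobject A, IsNormalSubobject K ∧
      ∃ e : F.obj (K : C) ≅ (K' : D), e.hom ≫ K'.arrow = F.map K.arrow

end Normality

end SemiAbelianCat

/-! Protomodularity says that a subobject containing both the section and the kernel of a point is
everything; hence relations are difunctional and reflexive relations are equivalences. The cycle
proved is (i) ⇒ (iii) ⇒ (ii) ⇒ (i).

(i) ⇒ (iii): a normal subobject of `ker α` is normal in `A`, say the kernel of `q`; the kernel in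
points of `⟨q, α⟩` restricts to it. Uniqueness is `le_of_isNormalSubobject_of_kernel`. (iii) ⇒ (ii):
the created subobject of a point is the required split extension. (ii) ⇒ (i): for `G` the kernel of
`q`, the kernel pair of `q` is a split extension by `G`. Lifting a normal `H` of `G` to it gives a
reflexive relation on `A`, which exactness makes a kernel pair; its zero class is `H`. -/

namespace SemiAbelianCat

variable {C : Type u} [Category.{v} C]

attribute [local simp] pullback.lift_fst pullback.lift_snd pullback.lift_fst_assoc
  pullback.lift_snd_assoc prod.lift_fst prod.lift_snd prod.lift_fst_assoc prod.lift_snd_assoc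

/-! ### Consequences of protomodularity: joint epicity and the Mal'tsev property -/

section Protomodularity

variable [HasZeroMorphisms C] [HasZeroObject C] [Protomodular C]

/-- In a pointed protomodular category the section of a point and the kernel of its projection are
jointly extremally epic. -/
theorem isIso_of_section_of_kernel {A B M : C} {α : A ⟶ B} {β : B ⟶ A} (h : β ≫ α = 𝟙 B)
    (m : M ⟶ A) [Mono m] (b : B ⟶ M) (hb : b ≫ m = β)
    (hk : ∀ {W : C} (t : W ⟶ A), t ≫ α = 0 → ∃ s : W ⟶ M, s ≫ m = t) : IsIso m := by
  obtain ⟨Z, hZ⟩ := HasZeroObject.zero (C := C)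
  let P : Point B := ⟨A, α, β, h⟩
  let Q : Point B := ⟨M, m ≫ α, b, by rw [← Category.assoc, hb, h]⟩
  let φ : Q ⟶ P := Point.Hom.mk (P := Q) (Q := P) m rfl hb
  -- Pulling back along the zero map from a zero object amounts to taking kernels, so isomorphisms
  -- of points are detected on kernels.
  let v : Z ⟶ B := 0
  have := Protomodular.reflectsIsomorphisms v
  have hsnd : pullback.fst P.α v ≫ α = 0 := by
    have := pullback.condition (f := P.α) (g := v)
    exact this.trans (by simp [v])
  obtain ⟨s, hs⟩ := hk _ hsnd
  let ψ : pullback P.α v ⟶ pullback Q.α v := pullback.lift s (pullback.snd _ _) (by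
    change s ≫ m ≫ α = _
    rw [← Category.assoc, hs, hsnd]
    simp [v])
  have hψ : ψ ≫ Point.pullbackHom v φ = 𝟙 _ := by
    apply pullback.hom_ext
    · rw [Category.assoc, Point.pullbackHom_fst, pullback.lift_fst_assoc, Category.id_comp]
      exact hs
    · rw [Category.assoc, Point.pullbackHom_snd, pullback.lift_snd, Category.id_comp]
  have hφ : Point.pullbackHom v φ ≫ ψ = 𝟙 _ := by
    apply pullback.hom_ext
    · have h₁ : (Point.pullbackHom v φ ≫ ψ) ≫ pullback.fst Q.α v = Point.pullbackHom v φ ≫ s :=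
        (Category.assoc _ _ _).trans (congrArg _ (pullback.lift_fst _ _ _))
      rw [← cancel_mono m, h₁, Category.assoc, hs, Point.pullbackHom_fst, Category.id_comp]
    · exact (Category.assoc _ _ _).trans ((congrArg _ (pullback.lift_snd _ _ _)).trans
        ((Point.pullbackHom_snd v φ).trans (Category.id_comp _).symm))
  have : IsIso ((Point.changeOfBase v).map φ) := by
    refine ⟨Point.Hom.mk (P := (Point.changeOfBase v).obj P) (Q := (Point.changeOfBase v).obj Q) ψ
      (pullback.lift_snd _ _ _) ?_, Point.hom_ext hφ, Point.hom_ext hψ⟩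
    have hβ := ((Point.changeOfBase v).map φ).β_comp =≫ ψ
    exact hβ.symm.trans ((Category.assoc _ _ _).trans
      ((congrArg _ hφ).trans (Category.comp_id _)))
  have : IsIso φ := isIso_of_reflects_iso φ (Point.changeOfBase v)
  exact ⟨⟨(inv φ).f, congrArg Point.Hom.f (IsIso.hom_inv_id φ),
    congrArg Point.Hom.f (IsIso.inv_hom_id φ)⟩⟩

/-- Two morphisms out of the total object of a point agree when they agree on the section and on
the kernel. -/
theorem hom_ext_of_section_of_kernel {A B Y : C} {α : A ⟶ B} {β : B ⟶ A} (h : β ≫ α = 𝟙 B)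
    {f g : A ⟶ Y} (hβ : β ≫ f = β ≫ g)
    (hk : ∀ {W : C} (t : W ⟶ A), t ≫ α = 0 → t ≫ f = t ≫ g) : f = g := by
  have := isIso_of_section_of_kernel h (equalizer.ι f g) (equalizer.lift β hβ)
    (equalizer.lift_ι _ _) fun t ht => ⟨equalizer.lift t (hk t ht), equalizer.lift_ι _ _⟩
  exact eq_of_epi_equalizer

/-- In a pointed protomodular category the two canonical sections of a pullback of split
epimorphisms are jointly extremally epic. -/
theorem isIso_of_pullback_sections {X Y B M : C} {f : X ⟶ B} {s : B ⟶ X} {g : Y ⟶ B} {t : B ⟶ Y}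
    (hs : s ≫ f = 𝟙 B) (ht : t ≫ g = 𝟙 B) (m : M ⟶ pullback f g) [Mono m] (x : X ⟶ M) (y : Y ⟶ M)
    (hx : x ≫ m = pullback.lift (𝟙 X) (f ≫ t) (by simp [ht]))
    (hy : y ≫ m = pullback.lift (g ≫ s) (𝟙 Y) (by simp [hs])) : IsIso m := by
  -- Kernel elements are pairs `(w, 0)` with `f w = 0`, so they equal `(w, t (f w))`, which `x`
  -- reaches.
  refine isIso_of_section_of_kernel (α := pullback.snd f g) (pullback.lift_snd _ _ _) m y hy
    fun w hw => ⟨(w ≫ pullback.fst f g) ≫ x, ?_⟩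
  rw [Category.assoc, hx]
  apply pullback.hom_ext
  · simp
  · have : w ≫ pullback.fst f g ≫ f = 0 := by
      rw [pullback.condition, ← Category.assoc, hw, zero_comp]
    rw [hw]
    simp [reassoc_of% this]

/-- Every relation in a pointed protomodular category is difunctional. -/
theorem exists_difunctional {S X Y : C} (p₁ : S ⟶ X) (p₂ : S ⟶ Y) [JointlyMono₂ p₁ p₂] {W : C}
    (a b c : W ⟶ S) (hab : a ≫ p₂ = b ≫ p₂) (hbc : b ≫ p₁ = c ≫ p₁) :
    ∃ d : W ⟶ S, d ≫ p₁ = a ≫ p₁ ∧ d ≫ p₂ = c ≫ p₂ := by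
  have : Mono (prod.lift p₁ p₂) := ⟨fun u w huw => JointlyMono₂.right_cancellation (p₁ := p₁)
    (p₂ := p₂) u w (by simpa using huw =≫ prod.fst) (by simpa using huw =≫ prod.snd)⟩
  let f : pullback p₂ p₂ ⟶ S := pullback.snd p₂ p₂
  let g : pullback p₁ p₁ ⟶ S := pullback.fst p₁ p₁
  let s : S ⟶ pullback p₂ p₂ := pullback.lift (𝟙 S) (𝟙 S) rfl
  let t : S ⟶ pullback p₁ p₁ := pullback.lift (𝟙 S) (𝟙 S) rfl
  have hs : s ≫ f = 𝟙 S := pullback.lift_snd _ _ _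
  have ht : t ≫ g = 𝟙 S := pullback.lift_fst _ _ _
  -- On triples `(a, b, c)` of composable zigzags, `r` is `(p₁ a, p₂ c)`, and `m` is the subobject
  -- where this pair lies in `S`. It contains every `(a, b, b)`, witnessed by `a`, and every `(b, b,
  -- c)`, witnessed by `c`.
  let r : pullback f g ⟶ X ⨯ Y := prod.lift (pullback.fst f g ≫ pullback.fst p₂ p₂ ≫ p₁)
    (pullback.snd f g ≫ pullback.snd p₁ p₁ ≫ p₂)
  let m := pullback.snd (prod.lift p₁ p₂) r
  have : IsIso m := by
    refine isIso_of_pullback_sections hs ht m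
      (pullback.lift (pullback.fst p₂ p₂) (pullback.lift (𝟙 _) (f ≫ t) (by simp [ht])) ?_)
      (pullback.lift (pullback.snd p₁ p₁) (pullback.lift (g ≫ s) (𝟙 _) (by simp [hs])) ?_)
      (pullback.lift_snd _ _ _) (pullback.lift_snd _ _ _)
    · apply Limits.prod.hom_ext
      · simp [r]
      · simp [r, t, f, pullback.condition]
    · apply Limits.prod.hom_ext
      · simp [r, s, g, pullback.condition]
      · simp [r]
  let w : W ⟶ pullback f g := pullback.lift (pullback.lift a b hab) (pullback.lift b c hbc)
    (by simp [f, g])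
  have hw : (w ≫ inv m ≫ pullback.fst _ _) ≫ prod.lift p₁ p₂ = w ≫ r := by
    rw [Category.assoc, Category.assoc, pullback.condition, IsIso.inv_hom_id_assoc]
  refine ⟨w ≫ inv m ≫ pullback.fst _ _, ?_, ?_⟩
  · simpa [w, r] using hw =≫ prod.fst
  · simpa [w, r] using hw =≫ prod.snd

/-- A pointed protomodular category is a Mal'tsev category: every reflexive relation is an
equivalence relation. -/
theorem isEquivalenceRelation_of_reflexive {S A : C} (p₁ p₂ : S ⟶ A) [JointlyMono₂ p₁ p₂]
    (r : A ⟶ S) (h₁ : r ≫ p₁ = 𝟙 A) (h₂ : r ≫ p₂ = 𝟙 A) : IsEquivalenceRelation p₁ p₂ := by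
  -- Symmetry uses the zigzag `(y,y), (x,y), (x,x)`; transitivity uses `(x,y), (y,y), (y,z)`.
  obtain ⟨s, hs₁, hs₂⟩ := exists_difunctional p₁ p₂ (p₂ ≫ r) (𝟙 S) (p₁ ≫ r) (by simp [h₂])
    (by simp [h₁])
  obtain ⟨t, ht₁, ht₂⟩ := exists_difunctional p₁ p₂ (pullback.fst p₂ p₁)
    (pullback.fst p₂ p₁ ≫ p₂ ≫ r) (pullback.snd p₂ p₁) (by simp [h₂])
    (by simp [h₁, pullback.condition])
  exact ⟨⟨{
    right_cancellation := JointlyMono₂.right_cancellation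
    r := r
    reflexivity₁ := h₁
    reflexivity₂ := h₂
    s := s
    symmetry₁ := by simpa [h₁] using hs₁
    symmetry₂ := by simpa [h₂] using hs₂
    c := pullback.cone p₂ p₁
    isLimit := pullback.isLimit p₂ p₁
    t := t
    transitivity₁ := ht₁
    transitivity₂ := ht₂ }⟩⟩

/-- A morphism of split extensions of a fixed object is monic when it is monic on kernels. -/
theorem SplitExtension.Hom.mono_onTotal {B X' X : C} {E' : SplitExtension B X'}
    {E : SplitExtension B X} (φ : E'.Hom E) (hB : φ.onBase = 𝟙 B) [Mono φ.onKernel] :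
    Mono φ.onTotal := by
  have hα : E'.α = φ.onTotal ≫ E.α := by rw [← φ.comm_α, hB, Category.comp_id]
  have : Mono E.κ := ⟨fun _ _ h => Fork.IsLimit.hom_ext E.isKernel h⟩
  -- The kernel pair of `φ.onTotal` is itself a point over `B`. Its diagonal contains the section,
  -- and contains the kernel because `φ` is monic there; so it is everything.
  let d := pullback.diagonal φ.onTotal
  have hα' : pullback.fst φ.onTotal φ.onTotal ≫ E'.α = pullback.snd _ _ ≫ E'.α := by
    rw [hα, pullback.condition_assoc]
  have : IsIso d := by
    refine isIso_of_section_of_kernel (α := pullback.fst φ.onTotal φ.onTotal ≫ E'.α)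
      (β := E'.β ≫ d) (by simp [d, E'.section_comp]) d E'.β rfl fun t ht => ?_
    obtain ⟨u, hu⟩ := KernelFork.IsLimit.lift' E'.isKernel (t ≫ pullback.fst _ _) (by simpa using ht)
    obtain ⟨w, hw⟩ := KernelFork.IsLimit.lift' E'.isKernel (t ≫ pullback.snd _ _)
      (by rw [Category.assoc, ← hα', ht])
    replace hu : u ≫ E'.κ = t ≫ pullback.fst _ _ := hu
    replace hw : w ≫ E'.κ = t ≫ pullback.snd _ _ := hw
    have huw : u = w := by
      rw [← cancel_mono φ.onKernel, ← cancel_mono E.κ, Category.assoc, Category.assoc, ← φ.comm_κ,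
        ← Category.assoc, ← Category.assoc, hu, hw, Category.assoc, Category.assoc,
        pullback.condition]
    refine ⟨u ≫ E'.κ, ?_⟩
    apply pullback.hom_ext
    · simp [d, hu]
    · simp [d, huw, hw]
  refine ⟨fun a b hab => ?_⟩
  have h : pullback.fst φ.onTotal φ.onTotal = pullback.snd _ _ := by
    rw [← cancel_epi d]
    simp [d]
  have := pullback.lift a b hab ≫= h
  simpa using this

end Protomodularity

/-! ### Normal monomorphisms via generalised elements -/

section Normality

variable [HasZeroMorphisms C]

theorem IsNormalMono.mono {X Y : C} {f : X ⟶ Y} (hf : IsNormalMono f) : Mono f :=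
  let ⟨n⟩ := hf
  ⟨fun _ _ h => Fork.IsLimit.hom_ext n.isLimit h⟩

theorem isNormalMono_iff {X Y : C} {f : X ⟶ Y} :
    IsNormalMono f ↔ Mono f ∧ ∃ (Z : C) (g : Y ⟶ Z), f ≫ g = 0 ∧
      ∀ {W : C} (t : W ⟶ Y), t ≫ g = 0 → ∃ s : W ⟶ X, s ≫ f = t := by
  constructor
  · intro hf
    obtain ⟨n⟩ := id hf
    refine ⟨hf.mono, n.Z, n.g, n.w, fun t ht => ?_⟩
    obtain ⟨s, hs⟩ := KernelFork.IsLimit.lift' n.isLimit t ht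
    exact ⟨s, hs⟩
  · rintro ⟨hm, Z, g, w, h⟩
    choose s hs using @h
    exact ⟨⟨Z, g, w, KernelFork.IsLimit.ofι' f w fun t ht => ⟨s t ht, hs t ht⟩⟩⟩

theorem IsNormalMono.of_iso {X X' Y : C} {f : X ⟶ Y} (hf : IsNormalMono f) (e : X' ≅ X)
    {f' : X' ⟶ Y} (h : e.hom ≫ f = f') : IsNormalMono f' := by
  subst h
  obtain ⟨hm, Z, g, w, hl⟩ := isNormalMono_iff.1 hf
  refine isNormalMono_iff.2 ⟨mono_comp _ _, Z, g, by simp [w], fun t ht => ?_⟩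
  obtain ⟨s, hs⟩ := hl t ht
  exact ⟨s ≫ e.inv, by simp [hs]⟩

theorem IsNormalMono.isNormalSubobject_mk {X Y : C} {f : X ⟶ Y} [Mono f] (hf : IsNormalMono f) :
    IsNormalSubobject (Subobject.mk f) :=
  hf.of_iso (Subobject.underlyingIso f) (Subobject.underlyingIso_hom_comp_eq_mk f)

end Normality

/-! ### The kernel inclusion of a point -/

section KernelFunctor

variable [HasZeroMorphisms C] [HasKernels C] {B : C}

/-- The inclusion of the kernel of the projection of a point. -/
noncomputable def Point.kernelι (P : Point B) : (kernelFunctor B).obj P ⟶ P.A :=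
  kernel.ι P.α

instance (P : Point B) : Mono P.kernelι :=
  inferInstanceAs (Mono (kernel.ι P.α))

theorem Point.kernelι_comp_α (P : Point B) : P.kernelι ≫ P.α = 0 :=
  kernel.condition P.α

theorem Point.exists_comp_kernelι (P : Point B) {W : C} (t : W ⟶ P.A) (ht : t ≫ P.α = 0) :
    ∃ s : W ⟶ (kernelFunctor B).obj P, s ≫ P.kernelι = t :=
  ⟨kernel.lift P.α t ht, kernel.lift_ι _ _ _⟩

theorem kernelFunctor_map_kernelι {P Q : Point B} (φ : P ⟶ Q) :
    (kernelFunctor B).map φ ≫ Q.kernelι = P.kernelι ≫ φ.f :=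
  kernel.lift_ι _ _ _

theorem Point.isNormalMono_kernelι (P : Point B) : IsNormalMono P.kernelι :=
  isNormalMono_iff.2 ⟨inferInstance, B, P.α, P.kernelι_comp_α, P.exists_comp_kernelι⟩

end KernelFunctor

/-! ### The three implications -/

section Equivalence

variable [HasZeroMorphisms C] [SemiAbelian C]

/-- If every normal subobject is characteristic, then normality is transitive. -/
theorem transitivityOfNormality_of_isCharacteristic
    (hC : ∀ (G : C) (H : Subobject G), IsNormalSubobject H → IsCharacteristic H) :
    TransitivityOfNormality C := by
  intro H G A f g hf hg
  have := hf.mono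
  have := hg.mono
  obtain ⟨-, Q, q, hgq, hlift⟩ := isNormalMono_iff.1 hg
  let κ : G ⟶ pullback q q := pullback.lift 0 g (by simp [hgq])
  have hκ : κ ≫ pullback.fst q q = 0 := pullback.lift_fst _ _ _
  have hκ' : κ ≫ pullback.snd q q = g := pullback.lift_snd _ _ _
  have : Mono κ := mono_of_mono_fac hκ'
  let E : SplitExtension A G :=
    { A := pullback q q
      κ := κ
      α := pullback.fst q q
      β := pullback.diagonal q
      section_comp := pullback.diagonal_fst q
      zero := hκ
      isKernel := KernelFork.IsLimit.ofι' κ hκ fun t ht => by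
        have h : (t ≫ pullback.snd q q) ≫ q = 0 := by
          rw [Category.assoc, ← pullback.condition, ← Category.assoc, ht, zero_comp]
        refine ⟨(hlift _ h).choose, ?_⟩
        apply pullback.hom_ext
        · rw [Category.assoc, hκ, comp_zero, ht]
        · rw [Category.assoc, hκ', (hlift _ h).choose_spec] }
  obtain ⟨E', φ, hφ, hB⟩ := hC G (Subobject.mk f) hf.isNormalSubobject_mk A E
  have : Mono φ.onKernel := hφ ▸ inferInstance
  have := φ.mono_onTotal hB
  let p₁ : E'.A ⟶ A := φ.onTotal ≫ pullback.fst q q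
  let p₂ : E'.A ⟶ A := φ.onTotal ≫ pullback.snd q q
  have hp₁ : p₁ = E'.α := by
    have := φ.comm_α
    rw [hB, Category.comp_id] at this
    exact this.symm
  have hβ : E'.β ≫ φ.onTotal = pullback.diagonal q := by
    have := φ.comm_β
    rw [hB, Category.id_comp] at this
    exact this
  have hκ₂ : E'.κ ≫ p₂ = (Subobject.mk f).arrow ≫ g := by
    have := φ.comm_κ =≫ pullback.snd q q
    rw [hφ, Category.assoc, Category.assoc] at this
    exact this.trans (congrArg _ hκ')
  have : JointlyMono₂ p₁ p₂ := ⟨fun _ a b h₁ h₂ => by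
    rw [← cancel_mono φ.onTotal]
    apply pullback.hom_ext
    · simpa [p₁] using h₁
    · simpa [p₂] using h₂⟩
  -- The kernel of `p` consists of the elements related to `0`, and these form the kernel of `p₁`
  -- embedded by `p₂`.
  obtain ⟨Y, p, hp⟩ := BarrExact.exists_isKernelPair p₁ p₂
    (isEquivalenceRelation_of_reflexive p₁ p₂ E'.β
      (by simp [p₁, reassoc_of% hβ]) (by simp [p₂, reassoc_of% hβ]))
  have hnormal : IsNormalMono ((Subobject.mk f).arrow ≫ g) := by
    refine isNormalMono_iff.2 ⟨mono_comp _ _, Y, p, ?_, fun t ht => ?_⟩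
    · rw [← hκ₂, Category.assoc, ← hp.w, hp₁, ← Category.assoc, E'.zero, zero_comp]
    · let s := hp.lift 0 t (by simp [ht])
      have hs₁ : s ≫ p₁ = 0 := hp.lift_fst _ _ _
      have hs₂ : s ≫ p₂ = t := hp.lift_snd _ _ _
      obtain ⟨u, hu⟩ := KernelFork.IsLimit.lift' E'.isKernel s (hp₁ ▸ hs₁)
      replace hu : u ≫ E'.κ = s := hu
      exact ⟨u, by rw [← hκ₂, ← Category.assoc, hu, hs₂]⟩
  exact hnormal.of_iso (Subobject.underlyingIso f).symm (by simp)

/-- If the kernel functors create normal subobjects, then normal subobjects are characteristic. -/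
theorem isCharacteristic_of_createsNormalSubobjects
    (hC : ∀ B : C, CreatesNormalSubobjects (kernelFunctor B : Point B ⥤ C)) (G : C)
    (H : Subobject G) (hH : IsNormalSubobject H) : IsCharacteristic H := by
  intro B E
  let P : Point B := ⟨E.A, E.α, E.β, E.section_comp⟩
  let i : (kernelFunctor B).obj P ≅ G := (kernelIsKernel E.α).conePointUniqueUpToIso E.isKernel
  have hi : i.hom ≫ E.κ = P.kernelι :=
    (kernelIsKernel E.α).conePointUniqueUpToIso_hom_comp E.isKernel WalkingParallelPair.zero
  let h : (H : C) ⟶ (kernelFunctor B).obj P := H.arrow ≫ i.inv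
  have hn : IsNormalMono h := by
    obtain ⟨-, Z, g, w, hl⟩ := isNormalMono_iff.1 hH
    refine isNormalMono_iff.2 ⟨mono_comp _ _, Z, i.hom ≫ g, by simp [h, w], fun t ht => ?_⟩
    obtain ⟨s, hs⟩ := hl (t ≫ i.hom) (by rw [Category.assoc, ht])
    exact ⟨s, by rw [← Category.assoc, hs, Category.assoc, i.hom_inv_id, Category.comp_id]⟩
  have : Mono h := hn.mono
  obtain ⟨K, ⟨-, e, he⟩, -⟩ := hC B P (Subobject.mk h) hn.isNormalSubobject_mk
  let R : Point B := (K : Point B)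
  let m : R ⟶ P := K.arrow
  let j : (kernelFunctor B).obj R ≅ (H : C) := e ≪≫ Subobject.underlyingIso h
  have hj : j.hom ≫ h = (kernelFunctor B).map m := by
    rw [← he]
    simp [j]
  have hm : R.kernelι ≫ m.f = j.hom ≫ H.arrow ≫ E.κ := by
    rw [← kernelFunctor_map_kernelι, ← hj, ← hi]
    simp [h]
  have hz : (j.inv ≫ R.kernelι) ≫ R.α = 0 := by
    rw [Category.assoc, R.kernelι_comp_α, comp_zero]
  let E' : SplitExtension B (H : C) :=
    { A := R.A
      κ := j.inv ≫ R.kernelι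
      α := R.α
      β := R.β
      section_comp := R.section_comp
      zero := hz
      isKernel := KernelFork.IsLimit.ofι' _ hz fun t ht =>
        ⟨(R.exists_comp_kernelι t ht).choose ≫ j.hom, by
          simpa using (R.exists_comp_kernelι t ht).choose_spec⟩ }
  exact ⟨E', ⟨H.arrow, m.f, 𝟙 B, by simp [E', hm], by
    rw [Category.comp_id]; exact m.comp_α.symm, by rw [Category.id_comp]; exact m.β_comp⟩, rfl, rfl⟩

/-- The kernel of the projection of a normal subobject of a point determines the subobject. -/
theorem le_of_isNormalSubobject_of_kernel {B : C} {P : Point B} {K L : Subobject P}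
    (hK : IsNormalSubobject K)
    (j : (kernelFunctor B).obj (L : Point B) ⟶ (kernelFunctor B).obj (K : Point B))
    (hj : j ≫ (kernelFunctor B).map K.arrow = (kernelFunctor B).map L.arrow) : L ≤ K := by
  obtain ⟨-, Q, q, hq, hl⟩ := isNormalMono_iff.1 hK
  -- Vanishing is tested on the section, where it is automatic, and on the kernel, where `L` factors
  -- through `K`.
  have hL : L.arrow ≫ q = 0 := by
    ext
    refine hom_ext_of_section_of_kernel (L : Point B).section_comp ?_ fun t ht => ?_
    · rw [(L.arrow ≫ q).β_comp, Point.Hom.β_comp]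
    · obtain ⟨u, rfl⟩ := Point.exists_comp_kernelι _ t ht
      have hq' : K.arrow.f ≫ q.f = (K : Point B).α ≫ Q.β := congrArg Point.Hom.f hq
      rw [Point.comp_f, Point.zero_f, Category.assoc, Category.assoc,
        reassoc_of% Point.kernelι_comp_α, ← reassoc_of% @kernelFunctor_map_kernelι, ← hj,
        Category.assoc, reassoc_of% @kernelFunctor_map_kernelι, hq',
        reassoc_of% Point.kernelι_comp_α]
      simp
  obtain ⟨s, hs⟩ := hl _ hL
  exact Subobject.le_of_comm s hs

/-- If normality is transitive, then the kernel functors create normal subobjects. -/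
theorem createsNormalSubobjects_of_transitivityOfNormality (hC : TransitivityOfNormality C)
    (B : C) : CreatesNormalSubobjects (kernelFunctor B : Point B ⥤ C) := by
  intro P K' hK'
  obtain ⟨-, Q, q, hq, hl⟩ :=
    isNormalMono_iff.1 (hC K'.arrow P.kernelι hK' P.isNormalMono_kernelι)
  -- The section is not `(0, 1)`, since `P.β ≫ q` need not vanish; this choice makes `⟨q, α⟩` a
  -- morphism of points.
  let T : Point B := ⟨Q ⨯ B, prod.snd, P.β ≫ prod.lift q P.α, by simp⟩
  let ψ : P ⟶ T := Point.Hom.mk (P := P) (Q := T) (prod.lift q P.α) (by simp [T]) rfl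
  -- `R` is the kernel of `ψ` in points: the `a` with `q a = q (β (α a))`. Where `α a = 0` this
  -- reads `q a = 0`, which cuts out `K'`.
  let R : Point B := ⟨pullback ψ.f T.β, pullback.snd _ _, pullback.lift P.β (𝟙 B) (by simp),
    pullback.lift_snd _ _ _⟩
  have hRα : pullback.fst ψ.f T.β ≫ P.α = R.α := by
    have := pullback.condition (f := ψ.f) (g := T.β) =≫ T.α
    rw [Category.assoc, Category.assoc, ψ.comp_α, T.section_comp, Category.comp_id] at this
    exact this
  let m : R ⟶ P := Point.Hom.mk (P := R) (Q := P) (pullback.fst _ _) hRα (pullback.lift_fst _ _ _)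
  have : Mono T.β := mono_of_mono_fac T.section_comp
  have : Mono m.f := inferInstanceAs (Mono (pullback.fst ψ.f T.β))
  have hmψ : m.f ≫ ψ.f = R.α ≫ T.β := pullback.condition
  have hm : IsNormalMono m := by
    have hmono : Mono m := ⟨fun a b hab => Point.hom_ext <|
      (cancel_mono m.f).1 (congrArg Point.Hom.f hab)⟩
    refine isNormalMono_iff.2 ⟨hmono, T, ψ, Point.hom_ext hmψ, fun {W} t ht => ?_⟩
    refine ⟨Point.Hom.mk (P := W) (Q := R)
      (pullback.lift t.f W.α (congrArg Point.Hom.f ht)) (pullback.lift_snd _ _ _) ?_, ?_⟩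
    · apply pullback.hom_ext <;> simp [R]
    · exact Point.hom_ext (pullback.lift_fst _ _ _)
  have : Mono m := hm.mono
  obtain ⟨d, hd⟩ := hl (R.kernelι ≫ m.f) (by
    have := (R.kernelι ≫= hmψ) =≫ prod.fst
    rw [reassoc_of% R.kernelι_comp_α] at this
    simpa [ψ] using this)
  replace hd : d ≫ K'.arrow = (kernelFunctor B).map m := by
    rw [← cancel_mono P.kernelι, Category.assoc, hd, kernelFunctor_map_kernelι]
  obtain ⟨c, hc⟩ := R.exists_comp_kernelι
    (pullback.lift (K'.arrow ≫ P.kernelι) 0 (by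
      apply Limits.prod.hom_ext
      · simpa [ψ] using hq
      · simp [ψ, P.kernelι_comp_α]) : (K' : C) ⟶ R.A) (pullback.lift_snd _ _ _)
  replace hc : c ≫ (kernelFunctor B).map m = K'.arrow := by
    rw [← cancel_mono P.kernelι, Category.assoc, kernelFunctor_map_kernelι, reassoc_of% hc]
    exact pullback.lift_fst _ _ _
  have : Mono ((kernelFunctor B).map m) := by
    have : Mono ((kernelFunctor B).map m ≫ P.kernelι) := by
      rw [kernelFunctor_map_kernelι]
      exact mono_comp _ _
    exact mono_of_mono _ P.kernelι
  let i : (kernelFunctor B).obj R ≅ (K' : C) :=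
    ⟨d, c, by rw [← cancel_mono ((kernelFunctor B).map m)]; simp [hc, hd],
      by rw [← cancel_mono K'.arrow]; simp [hc, hd]⟩
  let e := (kernelFunctor B).mapIso (Subobject.underlyingIso m) ≪≫ i
  have he : e.hom ≫ K'.arrow = (kernelFunctor B).map (Subobject.mk m).arrow := by
    simp [e, i, hd, ← Functor.map_comp]
  refine ⟨Subobject.mk m, ⟨hm.isNormalSubobject_mk, e, he⟩, ?_⟩
  rintro L ⟨hL, e', he'⟩
  exact le_antisymm
    (le_of_isNormalSubobject_of_kernel hm.isNormalSubobject_mk (e'.hom ≫ e.inv)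
      (by rw [← he, ← he']; simp))
    (le_of_isNormalSubobject_of_kernel hL (e.hom ≫ e'.inv) (by rw [← he, ← he']; simp))

end Equivalence

end SemiAbelianCat

theorem mainTheorem8 (C : Type u) [Category.{v} C] [HasZeroMorphisms C]
    [SemiAbelianCat.SemiAbelian C] :
    List.TFAE [
      SemiAbelianCat.TransitivityOfNormality C,
      ∀ (G : C) (H : Subobject G),
        SemiAbelianCat.IsNormalSubobject H → SemiAbelianCat.IsCharacteristic H,
      ∀ B : C, SemiAbelianCat.CreatesNormalSubobjects
        (SemiAbelianCat.kernelFunctor B : SemiAbelianCat.Point B ⥤ C)] := by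
  tfae_have 1 → 3 := SemiAbelianCat.createsNormalSubobjects_of_transitivityOfNormality
  tfae_have 3 → 2 := SemiAbelianCat.isCharacteristic_of_createsNormalSubobjects
  tfae_have 2 → 1 := SemiAbelianCat.transitivityOfNormality_of_isCharacteristic
  tfae_finish
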